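/- A partially ordered set is of finite length if there is a natural number $n$ such that none of its chains has more than $n+1$ elements. A tolerance on a lattice $L$ is a reflexive and symmetric relation $T\subseteq L\times L$ that is preserved by both lattice operations; its blocks are the maximal subsets $X\subseteq L$ with $X\times X\subseteq T$. A tolerance on a modular lattice of finite length is a doubling tolerance if each of its blocks has at most two elements. For a doubling tolerance $T$ on a modular lattice $L$ of finite length, let $\pi$ be the componentwise order on $L\times\{0,1\}$ (where $0<1$), that is, $(a,i)\mathrel{\pi}(b,j)$ if and only if $a\le b$ and $i\le j$. Let $\tau$ consist of the pairs $\big((a,1),(b,0)\big)$ such that the interval $[a,b]$ is a two-element block of $T$. Let $\rho$ be the transitive closure of $\pi\cup\tau$. Theorem. Let $T$ be a doubling tolerance on a modular lattice $L$ of finite length. Then $\rho$ is a partial order on $L\times\{0,1\}$, and $(L\times\{0,1\};\rho)$ is a modular lattice of finite length. If, in addition, $L$ is distributive, then $(L\times\{0,1\};\rho)$ is a distributive lattice. -/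

import Mathlib

/-- A partially ordered set (or any set with a relation `≤`) is of finite length if there is a
natural number `n` such that no chain in it has more than `n + 1` elements. -/
def FiniteLength (P : Type*) [LE P] : Prop :=
  ∃ n : ℕ, ∀ C : Set P, IsChain (· ≤ ·) C → C.encard ≤ (n : ℕ∞) + 1

/-- Distributivity of a lattice, as a proposition. -/
def IsDistributiveLattice (P : Type*) [Lattice P] : Prop :=
  ∀ x y z : P, x ⊓ (y ⊔ z) = (x ⊓ y) ⊔ (x ⊓ z)

/-- A (compatible) tolerance on a lattice: a reflexive and symmetric relation that is preserved by
both lattice operations. -/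
structure LatticeTolerance (L : Type*) [Lattice L] where
  rel : L → L → Prop
  refl' : ∀ a, rel a a
  symm' : ∀ a b, rel a b → rel b a
  sup' : ∀ a b c d, rel a b → rel c d → rel (a ⊔ c) (b ⊔ d)
  inf' : ∀ a b c d, rel a b → rel c d → rel (a ⊓ c) (b ⊓ d)

namespace LatticeTolerance

variable {L : Type*} [Lattice L] (T : LatticeTolerance L)

/-- The blocks of `T` are the maximal subsets `X` of `L` with `X × X ⊆ T`. -/
def IsBlock (X : Set L) : Prop :=
  Maximal (fun Y : Set L => ∀ a ∈ Y, ∀ b ∈ Y, T.rel a b) X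

/-- Every block has at most two elements. -/
def IsDoubling : Prop :=
  ∀ X : Set L, T.IsBlock X → X.encard ≤ 2

/-- The interval `[a, b]` is a two-element block of `T`. -/
def BlockCovers (a b : L) : Prop :=
  T.IsBlock (Set.Icc a b) ∧ (Set.Icc a b).encard = 2

/-- The extra steps, from `(a, 1)` up to `(b, 0)`, for each two-element block `[a, b]`. -/
def tau (x y : L × Fin 2) : Prop :=
  x.2 = 1 ∧ y.2 = 0 ∧ T.BlockCovers x.1 y.1

/-- The transitive closure of the union of the product order and `tau`. -/
def rho : L × Fin 2 → L × Fin 2 → Prop :=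
  Relation.TransGen (fun x y => x ≤ y ∨ T.tau x y)

/-- The doubled structure: the set `L × {0, 1}` with the relation `rho` as `≤`. -/
def Doubled {L : Type*} [Lattice L] (_T : LatticeTolerance L) : Type _ := L × Fin 2

instance instLEDoubled : LE T.Doubled := ⟨T.rho⟩

end LatticeTolerance

/-! The relation `rho` has a direct description (`rho_iff`): the first components are comparable,
and a step from level 1 to level 0 needs a related pair `c < d` between them. In a modular lattice
such separation survives cutting an interval at a point (`Separates.split`) and passing to a
transposed interval. Doubling forbids separating two sides of a square that meet at its bottom or at
its top. Splitting yields joins and meets lying over those of `L`. The inequality `x ⊓ (y ⊔ z) ≤ (x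
⊓ y) ⊔ (x ⊓ z)` lifts whenever it holds for first components (`doubled_distrib`), which gives both
modularity and distributivity. -/

namespace LatticeTolerance

/-! ### Blocks and separated intervals -/

section Separates

variable {L : Type*} [Lattice L] (T : LatticeTolerance L)

/-- Some pair of distinct comparable elements of the interval `[a, b]` is related by `T`. -/
def Separates (a b : L) : Prop :=
  ∃ c d, a ≤ c ∧ c < d ∧ d ≤ b ∧ T.rel c d

variable {T}

theorem Separates.mono {a b a' b' : L} (h : T.Separates a b) (ha : a' ≤ a) (hb : b ≤ b') :
    T.Separates a' b' := by
  obtain ⟨c, d, h1, h2, h3, h4⟩ := h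
  exact ⟨c, d, ha.trans h1, h2, h3.trans hb, h4⟩

theorem Separates.lt {a b : L} (h : T.Separates a b) : a < b := by
  obtain ⟨c, d, h1, h2, h3, -⟩ := h
  exact h1.trans_lt (h2.trans_le h3)

/-- A set of pairwise related elements extends to a block. -/
theorem exists_isBlock_superset {X : Set L} (hX : ∀ a ∈ X, ∀ b ∈ X, T.rel a b) :
    ∃ B, X ⊆ B ∧ T.IsBlock B := by
  refine zorn_subset_nonempty {Y : Set L | ∀ a ∈ Y, ∀ b ∈ Y, T.rel a b} ?_ X hX
  rintro c hc hchain -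
  refine ⟨⋃₀ c, ?_, fun s hs => Set.subset_sUnion_of_mem hs⟩
  rintro a ⟨s, hs, has⟩ b ⟨t, ht, hbt⟩
  rcases hchain.total hs ht with h | h
  · exact hc ht a (h has) b hbt
  · exact hc hs a has b (h hbt)

theorem IsDoubling.encard_le_two (hT : T.IsDoubling) {X : Set L}
    (hX : ∀ a ∈ X, ∀ b ∈ X, T.rel a b) : X.encard ≤ 2 := by
  obtain ⟨B, hXB, hB⟩ := exists_isBlock_superset hX
  exact (Set.encard_le_encard hXB).trans (hT B hB)

/-- An interval with related end points consists of pairwise related elements. -/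
theorem rel_of_mem_Icc {a b c d : L} (h : T.rel a b) (hc : c ∈ Set.Icc a b)
    (hd : d ∈ Set.Icc a b) : T.rel c d := by
  have h1 := T.sup' _ _ _ _ h (T.refl' c)
  have h2 := T.symm' _ _ (T.sup' _ _ _ _ h (T.refl' d))
  rw [sup_eq_right.2 hc.1, sup_eq_left.2 hc.2] at h1
  rw [sup_eq_right.2 hd.1, sup_eq_left.2 hd.2] at h2
  have h3 := T.inf' _ _ _ _ h1 h2
  rwa [inf_eq_left.2 hc.2, inf_eq_right.2 hd.2] at h3

theorem IsDoubling.blockCovers_iff (hT : T.IsDoubling) {a b : L} :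
    T.BlockCovers a b ↔ a < b ∧ T.rel a b := by
  constructor
  · rintro ⟨hB, hcard⟩
    have hle : a ≤ b := by
      by_contra h
      simp [Set.Icc_eq_empty h] at hcard
    have hne : a ≠ b := by
      rintro rfl
      simp at hcard
    exact ⟨lt_of_le_of_ne hle hne,
      hB.prop a (Set.left_mem_Icc.2 hle) b (Set.right_mem_Icc.2 hle)⟩
  · rintro ⟨hlt, hrel⟩
    obtain ⟨B, hIB, hB⟩ := exists_isBlock_superset (T := T) (X := Set.Icc a b)
      fun c hc d hd => rel_of_mem_Icc hrel hc hd
    have hpair : ({a, b} : Set L) ⊆ Set.Icc a b := by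
      rintro x (rfl | rfl)
      · exact Set.left_mem_Icc.2 hlt.le
      · exact Set.right_mem_Icc.2 hlt.le
    have h2 : ({a, b} : Set L).encard = 2 := Set.encard_pair hlt.ne
    have hfin : B.Finite := Set.finite_of_encard_le_coe (k := 2) (hT B hB)
    have hBeq : ({a, b} : Set L) = B :=
      hfin.eq_of_subset_of_encard_le' (hpair.trans hIB) (by rw [h2]; exact hT B hB)
    have hI : Set.Icc a b = B := hIB.antisymm (hBeq ▸ hpair)
    exact ⟨hI ▸ hB, by rw [hI, ← hBeq, h2]⟩

/-- Upper neighbours with respect to a doubling tolerance are unique. -/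
theorem IsDoubling.eq_of_rel_of_lt (hT : T.IsDoubling) {e x y : L} (hx : e < x) (hy : e < y)
    (hex : T.rel e x) (hey : T.rel e y) : x = y := by
  by_contra hne
  have hxy : T.rel x y := by
    have h := T.sup' _ _ _ _ (T.symm' _ _ hex) hey
    rwa [sup_eq_left.2 hx.le, sup_eq_right.2 hy.le] at h
  have hcard : ({e, x, y} : Set L).encard ≤ 2 := by
    refine hT.encard_le_two ?_
    rintro a (rfl | rfl | rfl) b (rfl | rfl | rfl)
    all_goals first
      | exact T.refl' _
      | assumption
      | (apply T.symm'; assumption)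
  rw [Set.encard_eq_three.2 ⟨e, x, y, hx.ne, hy.ne, hne, rfl⟩] at hcard
  exact absurd hcard (by decide)

end Separates

/-! ### Separation in modular lattices -/

section Modular

variable {L : Type*} [Lattice L] [IsModularLattice L] {T : LatticeTolerance L}

/-- By modularity, `c < d` cannot collapse under both meet and join with `s`. -/
theorem Separates.split {a b : L} (h : T.Separates a b) {s : L} (has : a ≤ s) (hsb : s ≤ b) :
    T.Separates a s ∨ T.Separates s b := by
  obtain ⟨c, d, h1, h2, h3, h4⟩ := h
  by_cases hle : d ⊔ s ≤ c ⊔ s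
  · exact .inl ⟨c ⊓ s, d ⊓ s, le_inf h1 has, inf_lt_inf_of_lt_of_sup_le_sup h2 hle, inf_le_right,
      T.inf' _ _ _ _ h4 (T.refl' s)⟩
  · exact .inr ⟨c ⊔ s, d ⊔ s, le_sup_right,
      lt_of_le_of_ne (sup_le_sup_right h2.le s) fun he => hle he.ge, sup_le h3 hsb,
      T.sup' _ _ _ _ h4 (T.refl' s)⟩

theorem Separates.inf_of_sup {a b : L} (h : T.Separates a (a ⊔ b)) : T.Separates (a ⊓ b) b := by
  obtain ⟨c, d, h1, h2, h3, h4⟩ := h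
  refine ⟨c ⊓ b, d ⊓ b, inf_le_inf_right b h1, inf_lt_inf_of_lt_of_sup_le_sup h2 ?_, inf_le_right,
    T.inf' _ _ _ _ h4 (T.refl' b)⟩
  exact (sup_le h3 le_sup_right).trans (sup_le_sup_right h1 b)

theorem Separates.sup_of_inf {a b : L} (h : T.Separates (a ⊓ b) b) : T.Separates a (a ⊔ b) := by
  obtain ⟨c, d, h1, h2, h3, h4⟩ := h
  refine ⟨c ⊔ a, d ⊔ a, le_sup_right, sup_lt_sup_of_lt_of_inf_le_inf h2 ?_,
    sup_le (h3.trans le_sup_right) le_sup_left, T.sup' _ _ _ _ h4 (T.refl' a)⟩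
  exact le_inf ((le_inf inf_le_right (inf_le_left.trans h3)).trans h1) inf_le_right

/-- The two lower sides of a square cannot both be separated by a doubling tolerance. -/
theorem IsDoubling.not_separates_inf (hT : T.IsDoubling) {a b : L}
    (ha : T.Separates (a ⊓ b) a) (hb : T.Separates (a ⊓ b) b) : False := by
  obtain ⟨c, d, h1, h2, h3, h4⟩ := ha
  obtain ⟨c', d', h1', h2', h3', h4'⟩ := hb
  have hca : (c ⊔ c') ⊓ a ≤ c := by
    rw [sup_inf_assoc_of_le c' (h2.le.trans h3)]
    exact sup_le le_rfl ((le_inf inf_le_right (inf_le_left.trans (h2'.le.trans h3'))).trans h1)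
  have hcb : (c ⊔ c') ⊓ b ≤ c' := by
    rw [sup_comm, sup_inf_assoc_of_le c (h2'.le.trans h3')]
    exact sup_le le_rfl ((le_inf (inf_le_left.trans (h2.le.trans h3)) inf_le_right).trans h1')
  have hca' : (c ⊔ d') ⊓ a ≤ c := by
    rw [sup_inf_assoc_of_le d' (h2.le.trans h3)]
    exact sup_le le_rfl ((le_inf inf_le_right (inf_le_left.trans h3')).trans h1)
  have hx : c ⊔ c' < d ⊔ c' := lt_of_le_not_ge (sup_le_sup_right h2.le _) fun h =>
    h2.not_ge ((le_inf (le_sup_left.trans h) h3).trans hca)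
  have hy : c ⊔ c' < c ⊔ d' := lt_of_le_not_ge (sup_le_sup_left h2'.le _) fun h =>
    h2'.not_ge ((le_inf (le_sup_right.trans h) h3').trans hcb)
  -- Both joins are related to `c ⊔ c'` and lie strictly above it, so they coincide, which forces `d
  -- ≤ c`.
  have he := hT.eq_of_rel_of_lt hx hy (T.sup' _ _ _ _ h4 (T.refl' c'))
    (T.sup' _ _ _ _ (T.refl' c) h4')
  exact h2.not_ge ((le_inf (le_sup_left.trans he.le) h3).trans hca')

theorem IsDoubling.not_separates_sup (hT : T.IsDoubling) {a b : L}
    (ha : T.Separates a (a ⊔ b)) (hb : T.Separates b (a ⊔ b)) : False := by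
  refine hT.not_separates_inf (a := a) (b := b) ?_ ha.inf_of_sup
  rw [inf_comm]
  exact (sup_comm a b ▸ hb).inf_of_sup

end Modular

/-! ### The doubled lattice -/

section Order

variable {L : Type*} [Lattice L] (T : LatticeTolerance L)

/-- An explicit description of `rho` for doubling tolerances. -/
def doubledLE (x y : L × Fin 2) : Prop :=
  x.1 ≤ y.1 ∧ (x.2 = 1 → y.2 = 0 → T.Separates x.1 y.1)

variable {T}

theorem doubledLE_refl (x : L × Fin 2) : T.doubledLE x x :=
  ⟨le_rfl, fun h h' => by simp [h] at h'⟩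

theorem doubledLE_trans {x y z : L × Fin 2} (h : T.doubledLE x y) (h' : T.doubledLE y z) :
    T.doubledLE x z := by
  refine ⟨h.1.trans h'.1, fun hx hz => ?_⟩
  rcases Fin.exists_fin_two.1 ⟨y.2, rfl⟩ with hy | hy
  · exact (h.2 hx hy).mono le_rfl h'.1
  · exact (h'.2 hy hz).mono h.1 le_rfl

theorem doubledLE_antisymm {x y : L × Fin 2} (h : T.doubledLE x y) (h' : T.doubledLE y x) :
    x = y := by
  have h1 : x.1 = y.1 := le_antisymm h.1 h'.1
  refine Prod.ext h1 ?_
  by_contra hne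
  obtain ⟨hx, hy⟩ | ⟨hx, hy⟩ : (x.2 = 1 ∧ y.2 = 0) ∨ (x.2 = 0 ∧ y.2 = 1) := by omega
  · exact (h.2 hx hy).lt.ne h1
  · exact (h'.2 hy hx).lt.ne h1.symm

theorem IsDoubling.rho_iff (hT : T.IsDoubling) {x y : L × Fin 2} :
    T.rho x y ↔ T.doubledLE x y := by
  constructor
  · intro h
    have step : ∀ u v : L × Fin 2, u ≤ v ∨ T.tau u v → T.doubledLE u v := by
      rintro u v (huv | ⟨-, -, huv⟩)
      · refine ⟨huv.1, fun hu hv => absurd huv.2 ?_⟩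
        rw [hu, hv]
        decide
      · obtain ⟨hlt, hrel⟩ := hT.blockCovers_iff.1 huv
        exact ⟨hlt.le, fun _ _ => ⟨_, _, le_rfl, hlt, le_rfl, hrel⟩⟩
    induction h with
    | single h => exact step _ _ h
    | tail _ h ih => exact doubledLE_trans ih (step _ _ h)
  · rintro ⟨h1, h2⟩
    by_cases hxy : x.2 = 1 ∧ y.2 = 0
    · obtain ⟨c, d, hc, hcd, hd, hrel⟩ := h2 hxy.1 hxy.2
      have s1 : x ≤ (c, 1) := ⟨hc, hxy.1.le⟩
      have s2 : T.tau (c, 1) (d, 0) := ⟨rfl, rfl, hT.blockCovers_iff.2 ⟨hcd, hrel⟩⟩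
      have s3 : ((d, 0) : L × Fin 2) ≤ y := ⟨hd, hxy.2.ge⟩
      exact ((Relation.TransGen.single (.inl s1)).tail (.inr s2)).tail (.inl s3)
    · exact .single (.inl ⟨h1, by omega⟩)

open Classical in
/-- The join in the doubled lattice. -/
noncomputable def doubledSup (T : LatticeTolerance L) (x y : L × Fin 2) : L × Fin 2 :=
  (x.1 ⊔ y.1, if T.doubledLE x (x.1 ⊔ y.1, 0) ∧ T.doubledLE y (x.1 ⊔ y.1, 0) then 0 else 1)

open Classical in
/-- The meet in the doubled lattice. -/
noncomputable def doubledInf (T : LatticeTolerance L) (x y : L × Fin 2) : L × Fin 2 :=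
  (x.1 ⊓ y.1, if T.doubledLE (x.1 ⊓ y.1, 1) x ∧ T.doubledLE (x.1 ⊓ y.1, 1) y then 1 else 0)

theorem doubledLE_sup (x y : L × Fin 2) :
    T.doubledLE x (T.doubledSup x y) ∧ T.doubledLE y (T.doubledSup x y) := by
  unfold doubledSup
  split_ifs with h
  · exact h
  · exact ⟨⟨le_sup_left, by simp⟩, ⟨le_sup_right, by simp⟩⟩

theorem doubledInf_le (x y : L × Fin 2) :
    T.doubledLE (T.doubledInf x y) x ∧ T.doubledLE (T.doubledInf x y) y := by
  unfold doubledInf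
  split_ifs with h
  · exact h
  · exact ⟨⟨inf_le_left, by simp⟩, ⟨inf_le_right, by simp⟩⟩

variable [IsModularLattice L]

theorem doubledSup_le {x y z : L × Fin 2} (hx : T.doubledLE x z) (hy : T.doubledLE y z) :
    T.doubledLE (T.doubledSup x y) z := by
  refine ⟨sup_le hx.1 hy.1, fun h hz => ?_⟩
  by_contra hsep
  refine absurd h ?_
  have hx' : T.doubledLE x (x.1 ⊔ y.1, 0) := ⟨le_sup_left, fun h _ =>
    ((hx.2 h hz).split le_sup_left (sup_le hx.1 hy.1)).resolve_right hsep⟩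
  have hy' : T.doubledLE y (x.1 ⊔ y.1, 0) := ⟨le_sup_right, fun h _ =>
    ((hy.2 h hz).split le_sup_right (sup_le hx.1 hy.1)).resolve_right hsep⟩
  simp [doubledSup, hx', hy']

theorem le_doubledInf {x y z : L × Fin 2} (hx : T.doubledLE z x) (hy : T.doubledLE z y) :
    T.doubledLE z (T.doubledInf x y) := by
  refine ⟨le_inf hx.1 hy.1, fun hz h => ?_⟩
  by_contra hsep
  refine absurd h ?_
  have hx' : T.doubledLE (x.1 ⊓ y.1, 1) x := ⟨inf_le_left, fun _ h =>
    ((hx.2 hz h).split (le_inf hx.1 hy.1) inf_le_left).resolve_left hsep⟩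
  have hy' : T.doubledLE (x.1 ⊓ y.1, 1) y := ⟨inf_le_right, fun _ h =>
    ((hy.2 hz h).split (le_inf hx.1 hy.1) inf_le_right).resolve_left hsep⟩
  simp [doubledInf, hx', hy']

/-- The lattice structure on the doubled set. -/
@[reducible]
noncomputable def doubledLattice (T : LatticeTolerance L) : Lattice T.Doubled where
  le := T.doubledLE
  le_refl := doubledLE_refl
  le_trans _ _ _ := doubledLE_trans
  le_antisymm _ _ := doubledLE_antisymm
  sup := T.doubledSup
  inf := T.doubledInf
  le_sup_left x y := (doubledLE_sup x y).1
  le_sup_right x y := (doubledLE_sup x y).2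
  sup_le _ _ _ := doubledSup_le
  inf_le_left x y := (doubledInf_le x y).1
  inf_le_right x y := (doubledInf_le x y).2
  le_inf _ _ _ := le_doubledInf

/-- If `y` is a lower element and `[a ⊓ b, b]` is not separated, then the distributive inequality
holds in the second component. -/
theorem IsDoubling.distrib_aux (hT : T.IsDoubling) {a : L} {y z : L × Fin 2}
    (hy : y.2 = 0) (hb : ¬ T.Separates (a ⊓ y.1) y.1)
    (hz : z.2 = 0 ∧ ¬ T.Separates (a ⊓ z.1) z.1 ∨
      T.Separates (a ⊓ z.1) (a ⊓ y.1 ⊔ a ⊓ z.1))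
    (hle : T.doubledLE (a ⊓ y.1 ⊔ a ⊓ z.1, 1) (T.doubledSup y z)) : False := by
  set w := a ⊓ y.1 ⊔ a ⊓ z.1 with hw
  have hwy : ¬ T.Separates w (w ⊔ y.1) := fun h =>
    hb (h.inf_of_sup.mono (le_inf le_sup_left inf_le_right) le_rfl)
  have hwz : w ⊔ y.1 ≤ y.1 ⊔ z.1 :=
    sup_le (sup_le_sup inf_le_right inf_le_right) le_sup_left
  have hy0 : T.doubledLE y (y.1 ⊔ z.1, 0) := ⟨le_sup_left, by simp [hy]⟩
  -- The join then has level 0, so `[w, y.1 ⊔ z.1]` is separated, and not in its part below `w ⊔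
  -- y.1`.
  have key : T.doubledLE z (y.1 ⊔ z.1, 0) → T.Separates (w ⊔ y.1) (y.1 ⊔ z.1) := fun hz0 => by
    have h : T.Separates w (y.1 ⊔ z.1) := hle.2 rfl (by simp [doubledSup, hy0, hz0])
    exact (h.split le_sup_left hwz).resolve_left hwy
  rcases hz with ⟨hz, hc⟩ | hc
  · have h := key ⟨le_sup_right, by simp [hz]⟩
    have he : y.1 ⊔ z.1 = (w ⊔ y.1) ⊔ z.1 :=
      le_antisymm (sup_le_sup_right le_sup_right _) (sup_le hwz le_sup_right)
    rw [he] at h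
    exact hc (h.inf_of_sup.mono (le_inf (le_sup_right.trans le_sup_left) inf_le_right) le_rfl)
  -- Transpose the separation down to an interval below `a ⊓ y.1`, then up to one above `z.1`.
  · have h1 : T.Separates z.1 (y.1 ⊔ z.1) := by
      rw [hw, sup_comm] at hc
      have h2 := hc.inf_of_sup
      have h3 : T.Separates (z.1 ⊓ (a ⊓ y.1)) (a ⊓ y.1) :=
        h2.mono (le_inf (le_inf (inf_le_right.trans inf_le_left) inf_le_left) inf_le_right) le_rfl
      exact h3.sup_of_inf.mono le_rfl (sup_le le_sup_right (inf_le_right.trans le_sup_left))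
    have h2 := key ⟨le_sup_right, fun _ _ => h1⟩
    exact hT.not_separates_sup (h2.mono le_sup_right le_rfl) h1

/-- A distributive inequality in `L` lifts to the doubled lattice. -/
theorem IsDoubling.doubled_distrib (hT : T.IsDoubling) {x y z : L × Fin 2}
    (h : x.1 ⊓ (y.1 ⊔ z.1) ≤ x.1 ⊓ y.1 ⊔ x.1 ⊓ z.1) :
    T.doubledLE (T.doubledInf x (T.doubledSup y z))
      (T.doubledSup (T.doubledInf x y) (T.doubledInf x z)) := by
  have hw : x.1 ⊓ (y.1 ⊔ z.1) = x.1 ⊓ y.1 ⊔ x.1 ⊓ z.1 := le_antisymm h le_inf_sup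
  refine ⟨h, fun hv hu => False.elim ?_⟩
  have hlo := doubledInf_le (T := T) x (T.doubledSup y z)
  have hup := doubledLE_sup (T := T) (T.doubledInf x y) (T.doubledInf x z)
  have hv' : T.doubledInf x (T.doubledSup y z) = (x.1 ⊓ y.1 ⊔ x.1 ⊓ z.1, 1) := Prod.ext hw hv
  have hu' : T.doubledSup (T.doubledInf x y) (T.doubledInf x z) =
      (x.1 ⊓ y.1 ⊔ x.1 ⊓ z.1, 0) := Prod.ext rfl hu
  rw [hv'] at hlo
  rw [hu'] at hup
  -- The bound of `hlo` by `x` rules out `x` as the obstruction to level 1, so only `t` can force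
  -- the meet to level 0.
  have alt : ∀ t : L × Fin 2, x.1 ⊓ t.1 ≤ x.1 ⊓ y.1 ⊔ x.1 ⊓ z.1 →
      T.doubledLE (T.doubledInf x t) (x.1 ⊓ y.1 ⊔ x.1 ⊓ z.1, 0) →
      t.2 = 0 ∧ ¬ T.Separates (x.1 ⊓ t.1) t.1 ∨
        T.Separates (x.1 ⊓ t.1) (x.1 ⊓ y.1 ⊔ x.1 ⊓ z.1) := by
    intro t htw ht
    by_cases hbit : T.doubledLE (x.1 ⊓ t.1, 1) t
    · right
      have hx1 : T.doubledLE (x.1 ⊓ t.1, 1) x :=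
        doubledLE_trans (y := (x.1 ⊓ y.1 ⊔ x.1 ⊓ z.1, 1)) ⟨htw, by simp⟩ hlo.1
      exact ht.2 (by simp [doubledInf, hbit, hx1]) rfl
    · left
      constructor
      · by_contra h0
        exact hbit ⟨inf_le_right, fun _ h => absurd h h0⟩
      · exact fun hs => hbit ⟨inf_le_right, fun _ _ => hs⟩
  have hy := alt y le_sup_left hup.1
  have hz := alt z le_sup_right hup.2
  rcases hy with ⟨hy, hb⟩ | hy
  · exact hT.distrib_aux hy hb hz hlo.2
  · rcases hz with ⟨hz, hc⟩ | hz
    · refine hT.distrib_aux (a := x.1) (y := z) (z := y) hz hc (.inr ?_) ?_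
      · rwa [sup_comm]
      · rw [sup_comm]
        exact doubledLE_trans hlo.2 (doubledSup_le (doubledLE_sup z y).2 (doubledLE_sup z y).1)
    · exact hT.not_separates_sup hy hz

end Order

end LatticeTolerance

open LatticeTolerance

theorem mainTheorem1 {L : Type*} [Lattice L] [IsModularLattice L] (hL : FiniteLength L)
    (T : LatticeTolerance L) (hT : T.IsDoubling) :
    FiniteLength T.Doubled ∧
    ∃ M : Lattice T.Doubled,
      (∀ x y : T.Doubled, M.toLE.le x y ↔ T.rho x y) ∧
      @IsModularLattice T.Doubled M ∧
      (IsDistributiveLattice L → @IsDistributiveLattice T.Doubled M) := by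
  refine ⟨?_, T.doubledLattice, fun x y => hT.rho_iff.symm, ?_, ?_⟩
  · obtain ⟨n, hn⟩ := hL
    -- Each fibre over `L` has two points, and `2 * (n + 1) = (2 * n + 1) + 1`.
    refine ⟨2 * n + 1, fun C hC => ?_⟩
    let D : Set (L × Fin 2) := C
    have hchain : IsChain (· ≤ ·) (Prod.fst '' D) := by
      rintro _ ⟨x, hx, rfl⟩ _ ⟨y, hy, rfl⟩ hne
      have hxy : x ≠ y := fun h => hne (congrArg _ h)
      rcases hC hx hy hxy with h | h
      · exact .inl (hT.rho_iff.1 h).1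
      · exact .inr (hT.rho_iff.1 h).1
    have hsub : D ⊆ (Prod.fst '' D) ×ˢ (Set.univ : Set (Fin 2)) :=
      fun x hx => ⟨⟨x, hx, rfl⟩, trivial⟩
    calc C.encard ≤ ((Prod.fst '' D) ×ˢ (Set.univ : Set (Fin 2))).encard :=
          Set.encard_le_encard hsub
      _ = (Prod.fst '' D).encard * 2 := by
          rw [Set.encard_prod, Set.encard_univ]
          simp
      _ ≤ ((n : ℕ∞) + 1) * 2 := by
          gcongr
          exact hn _ hchain
      _ = ((2 * n + 1 : ℕ) : ℕ∞) + 1 := by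
          push_cast
          ring
  · let := T.doubledLattice
    refine ⟨fun {x} y {z} hxz => ?_⟩
    have hle : x.1 ≤ z.1 := hxz.1
    have h : T.doubledLE (z ⊓ (x ⊔ y) : T.Doubled) (z ⊓ x ⊔ z ⊓ y : T.Doubled) := by
      refine hT.doubled_distrib (x := z) (y := x) (z := y) ?_
      rw [inf_eq_right.2 hle, inf_comm, sup_inf_assoc_of_le _ hle, inf_comm]
    rw [inf_comm (x ⊔ y), inf_comm y]
    rwa [inf_eq_right.2 hxz] at h
  · intro hD
    let := T.doubledLattice
    intro x y z
    exact doubledLE_antisymm (hT.doubled_distrib (hD _ _ _).le) (le_inf_sup (a := x))
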